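/- Let $\mu$ be a probability distribution on $\mathbb{N}=\{0,1,2,\dots\}$ with $\mu(0)=0$ and $\sum_{i\ge 0} i\,\mu(i)>1$ (the mean may be infinite), and let $\mathbf{T}$ be a Galton--Watson plane tree with offspring distribution $\mu$, rooted at $\rho$; almost surely it is locally finite and has no leaf. Draw $\mathbf{T}$ properly in the plane, and let $f_0,f_1,f_2,\dots$ be the faces of this drawing, where $f_0$ is the face between the leftmost ray $\gamma_\ell$ and the rightmost ray $\gamma_r$ of $\mathbf{T}$. Each face has a unique lowest vertex. A strip is a locally finite, connected, one-ended planar map with exactly one face of infinite degree, such that the boundary of this infinite face is simple, and which is equipped with a root vertex on this boundary. For every $i\ge 1$ let $s_i$ be a strip. No assumption is made on the family $(s_i)$: the strips may be deterministic or random, and may depend arbitrarily on each other and on $\mathbf{T}$. Let $\mathcal{S}=\mathcal{S}(\mathbf{T},(s_i))$ be the map obtained from $\mathbf{T}$ by gluing, for every $i\ge 1$, the strip $s_i$ in the face $f_i$, identifying the boundary of the infinite face of $s_i$ with the boundary of $f_i$ in such a way that the root of $s_i$ is identified with the lowest vertex of $f_i$ (nothing is glued in $f_0$, so that $\gamma_\ell$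 and $\gamma_r$ are the left and right boundaries of $\mathcal{S}$). Then there is a random variable $K$ with values in $\mathbb{N}$ such that, almost surely, every geodesic (for the graph distance of $\mathcal{S}$) in $\mathcal{S}$ from a vertex of $\gamma_\ell$ to a vertex of $\gamma_r$ contains a vertex at graph distance in $\mathcal{S}$ at most $K$ from $\rho$. -/

import Mathlib

open MeasureTheory ProbabilityTheory
open scoped ENNReal

universe u v

/-! ### Plane trees and Galton-Watson trees -/

/-- A rooted, locally finite plane tree in Ulam-Harris coding: a set of words containing the empty
word (the root), closed under prefixes, in which the children of a vertex `w` are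
`w ++ [0], …, w ++ [n - 1]`, listed from left to right, for some finite `n`. -/
structure PlaneTree where
  verts : Set (List ℕ)
  nil_mem : [] ∈ verts
  mem_of_prefix : ∀ w w' : List ℕ, w <+: w' → w' ∈ verts → w ∈ verts
  exists_count : ∀ w ∈ verts, ∃ n : ℕ, ∀ j : ℕ, w ++ [j] ∈ verts ↔ j < n

namespace PlaneTree

/-- The sigma-algebra on plane trees generated by the events `w ∈ t`, for words `w`. -/
instance instMeasurableSpace : MeasurableSpace PlaneTree :=
  MeasurableSpace.comap PlaneTree.verts inferInstance

/-- The tree in which every vertex `w` has `c w` children. -/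
def ofCounts (c : List ℕ → ℕ) : PlaneTree where
  verts := {w | ∀ (p : List ℕ) (j : ℕ), p ++ [j] <+: w → j < c p}
  nil_mem := by
    intro p j h
    simp at h
  mem_of_prefix := fun _ _ h hw p j hp => hw p j (hp.trans h)
  exists_count := by
    intro w hw
    refine ⟨c w, fun j => ⟨fun h => h w j (List.prefix_refl _), fun hj p i hp => ?_⟩⟩
    rcases List.prefix_concat_iff.1 hp with h | h
    · obtain ⟨rfl, h2⟩ := List.append_inj' h rfl
      simp only [List.cons.injEq, and_true] at h2
      exact h2 ▸ hj
    · exact hw p i h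

theorem measurable_ofCounts : Measurable ofCounts := by
  rw [measurable_comap_iff]
  refine measurable_set_iff.2 fun w => ?_
  change Measurable fun c : List ℕ → ℕ => ∀ (p : List ℕ) (j : ℕ), p ++ [j] <+: w → j < c p
  refine Measurable.forall fun p => Measurable.forall fun j => ?_
  by_cases h : p ++ [j] <+: w
  · simp only [h, true_imp_iff]
    exact measurableSet_setOfPred.1
      (measurableSet_lt measurable_const (measurable_pi_apply p))
  · simp only [h, false_imp_iff]
    exact measurable_const

/-- The law of the Galton-Watson tree with offspring distribution `μ`: the numbers of children are
independent with law `μ`. -/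
noncomputable def galtonWatson (μ : PMF ℕ) : Measure PlaneTree :=
  (Measure.infinitePi fun _ : List ℕ => μ.toMeasure).map ofCounts

instance (μ : PMF ℕ) : IsProbabilityMeasure (galtonWatson μ) :=
  Measure.isProbabilityMeasure_map measurable_ofCounts.aemeasurable

/-- The number of children of `w` in `t`. -/
noncomputable def childCount (t : PlaneTree) (w : List ℕ) : ℕ :=
  {j : ℕ | w ++ [j] ∈ t.verts}.ncard

/-- The leftmost path going up from `w`: go `n` times to the leftmost child. -/
def leftmost (w : List ℕ) (n : ℕ) : List ℕ := w ++ List.replicate n 0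

/-- The rightmost path going up from `w`: go `n` times to the rightmost child. -/
noncomputable def rightmost (t : PlaneTree) (w : List ℕ) : ℕ → List ℕ
  | 0 => w
  | n + 1 => t.rightmost w n ++ [t.childCount (t.rightmost w n) - 1]

/-- The faces of a leafless plane tree other than the one between its leftmost and rightmost rays:
a face is given by its lowest vertex `base` and by the index `idx` such that it lies between the
children number `idx` and `idx + 1` of `base` (so there are `t.childCount w - 1` faces with lowest
vertex `w`). -/
@[ext]
structure Face (t : PlaneTree) where
  base : List ℕ
  idx : ℕ
  base_mem : base ∈ t.verts
  idx_mem : base ++ [idx + 1] ∈ t.verts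

/-- The boundary of a face, as a bi-infinite path of words indexed so that `0` is the lowest vertex,
the positive indices go up along the left side of the face, which is the rightmost ray from child
number `idx`, and the negative indices go up along the right side of the face, which is the
leftmost ray from child number `idx + 1`. -/
noncomputable def Face.boundary {t : PlaneTree} (f : t.Face) : ℤ → List ℕ
  | Int.ofNat 0 => f.base
  | Int.ofNat (n + 1) => t.rightmost (f.base ++ [f.idx]) n
  | Int.negSucc n => leftmost (f.base ++ [f.idx + 1]) n

end PlaneTree

/-! ### Planar maps and strips -/

/-- A (possibly infinite) map, with loops and multiple edges allowed, given by its oriented edges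
(darts): `flip` reverses a dart, and `next` sends a dart to the next one with the same origin, in
counterclockwise order. -/
structure CombinatorialMap where
  Dart : Type u
  flip : Equiv.Perm Dart
  next : Equiv.Perm Dart
  flip_flip : ∀ d, flip (flip d) = d
  flip_ne : ∀ d, flip d ≠ d

namespace CombinatorialMap

variable (M : CombinatorialMap.{u})

/-- Vertices are the cycles of `next`. -/
def Vertex : Type u := Quotient (Equiv.Perm.SameCycle.setoid M.next)

/-- The vertex from which a dart starts. -/
def origin (d : M.Dart) : M.Vertex := Quotient.mk (Equiv.Perm.SameCycle.setoid M.next) d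

/-- The underlying graph, without loops and multiple edges: these play no role for distances. -/
def graph : SimpleGraph M.Vertex :=
  SimpleGraph.fromRel fun x y => ∃ d, M.origin d = x ∧ M.origin (M.flip d) = y

/-- The permutation that sends a dart to the following one along the face on its left. Faces are
the cycles of this permutation, and the size of a cycle is the degree of the face. -/
def faceNext : Equiv.Perm M.Dart := M.next⁻¹ * M.flip

/-- The step along a face in the submap that only keeps the edges whose darts are in `F`. -/
def SubmapFaceStep (F : Set M.Dart) (d e : F) : Prop :=
  ∃ k : ℕ, (M.next⁻¹ ^ (k + 1)) (M.flip d) = e ∧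
    ∀ i < k, (M.next⁻¹ ^ (i + 1)) (M.flip d) ∉ F

/-- A locally finite map is planar if each of its finite submaps has genus zero, by the Euler formula
`#vertices - #edges + #faces = 2 * #components`, with the faces counted on each component
separately. -/
def IsPlanar : Prop :=
  ∀ F : Set M.Dart, F.Finite → (∀ d ∈ F, M.flip d ∈ F) →
    (Nat.card (Quot fun d e : F => M.origin d = M.origin e) : ℤ)
      - Nat.card (Quot fun d e : F => M.flip d = e)
      + Nat.card (Quot (M.SubmapFaceStep F))
    = 2 * Nat.card (Quot fun d e : F => M.origin d = M.origin e ∨ M.flip d = e)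

end CombinatorialMap

/-- A strip: a locally finite, connected, one-ended planar map with exactly one face of infinite
degree (the outer face), whose boundary is simple, rooted at a vertex of this boundary. The root
vertex is given by the unique dart `root` that starts from it and has the outer face on its left. -/
structure Strip extends CombinatorialMap.{u} where
  finite_degree : ∀ d, {e | toCombinatorialMap.next.SameCycle d e}.Finite
  connected : toCombinatorialMap.graph.Connected
  planar : toCombinatorialMap.IsPlanar
  one_ended : ∃! e, e ∈ toCombinatorialMap.graph.end
  root : Dart
  infinite_face_iff : ∀ d, {e | toCombinatorialMap.faceNext.SameCycle d e}.Infinite ↔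
    toCombinatorialMap.faceNext.SameCycle root d
  simple_boundary : Function.Injective fun n : ℤ =>
    toCombinatorialMap.origin ((toCombinatorialMap.faceNext ^ n) root)

/-- The boundary of a strip as a bi-infinite path which is at the root at time `0` and keeps the
outer face on its left. For a strip drawn with its root at the bottom, the positive times go up
along its left side, and the negative times go up along its right side. -/
def Strip.boundary (S : Strip.{u}) (n : ℤ) : S.Vertex := S.origin ((S.faceNext ^ n) S.root)

/-! ### The slice -/

namespace PlaneTree

variable (t : PlaneTree) (s : t.Face → Strip.{u})

/-- Gluing of the strips: the boundary of the strip `s f` is identified with the boundary of the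
face `f`, its root being identified with the lowest vertex of `f`. -/
inductive Glue : t.verts ⊕ (Σ f : t.Face, (s f).Vertex) →
    t.verts ⊕ (Σ f : t.Face, (s f).Vertex) → Prop
  | mk (f : t.Face) (n : ℤ) (w : t.verts) (h : (w : List ℕ) = f.boundary n) :
      Glue (Sum.inl w) (Sum.inr ⟨f, (s f).boundary n⟩)

/-- The vertices of the slice: those of the tree and of the strips, after gluing. -/
def SliceVertex : Type u := Quot (t.Glue s)

/-- The vertex of the slice given by a vertex of the tree. -/
def treeVertex (w : t.verts) : t.SliceVertex s := Quot.mk _ (Sum.inl w)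

/-- The vertex of the slice given by a vertex of a strip. -/
def stripVertex (f : t.Face) (x : (s f).Vertex) : t.SliceVertex s := Quot.mk _ (Sum.inr ⟨f, x⟩)

/-- The edges of the slice: those of the tree and those of the strips. -/
inductive SliceEdge : t.SliceVertex s → t.SliceVertex s → Prop
  | tree (w w' : t.verts) (j : ℕ) (h : (w' : List ℕ) = w ++ [j]) :
      SliceEdge (t.treeVertex s w) (t.treeVertex s w')
  | strip (f : t.Face) (x y : (s f).Vertex) (h : (s f).graph.Adj x y) :
      SliceEdge (t.stripVertex s f x) (t.stripVertex s f y)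

/-- The (underlying graph of the) slice obtained by gluing the strip `s f` in the face `f`, for every
face `f` other than the one between the leftmost and the rightmost rays of `t`. -/
def slice : SimpleGraph (t.SliceVertex s) := SimpleGraph.fromRel (t.SliceEdge s)

/-- The root of the slice. -/
def sliceRoot : t.SliceVertex s := t.treeVertex s ⟨[], t.nil_mem⟩

/-- The left boundary of the slice, which is the leftmost ray of `t`. -/
def leftBoundary : Set (t.SliceVertex s) :=
  {x | ∃ w : t.verts, (∃ n, (w : List ℕ) = leftmost [] n) ∧ x = t.treeVertex s w}

/-- The right boundary of the slice, which is the rightmost ray of `t`. -/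
def rightBoundary : Set (t.SliceVertex s) :=
  {x | ∃ w : t.verts, (∃ n, (w : List ℕ) = t.rightmost [] n) ∧ x = t.treeVertex s w}

end PlaneTree

/-!
Let a unit mass start from the root of the tree, and let each vertex share the mass it receives
equally between its children. A vertex `w` then occupies a subinterval of `[0, 1]` whose length is
its mass `ν(w)`, and each face determines a point of `[0, 1]`, which separates the intervals of the
children on both sides of it. This point belongs to the intervals of all the vertices on the
boundary of the face. Give to a vertex in the interior of a strip the point of its face. Adjacent
vertices of the slice then have intersecting sets, whatever the strips are, so a path from the left
boundary to the right boundary covers `[0, 1]`, and the masses of the vertices of the tree on this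
path have a sum at least `1` (`PlaneTree.one_le_sum_sliceMass`).

A vertex of generation `n` is at distance at most `n` from the root of the slice, and a geodesic
contains at most `2 n + 1` vertices at distance `n` from the root. If the masses satisfy
`ν(w) ≤ C ϑ ^ |w|` with `ϑ < 1`, the sum of the masses along a geodesic that stays at distance more
than `K` from the root is therefore at most the sum of `C (2 n + 1) ϑ ^ n` over `n > K`. This is less
than `1` for a value of `K` that depends only on `C` and `ϑ`
(`PlaneTree.exists_dist_le_of_mass_le`).

It remains to see that the masses decay exponentially. The sum of `ν(w) ^ 2` over generation `n` has
mean `q ^ n`, where `q` is the mean of the inverse of the number of children, and `q < 1` because a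
vertex has at least two children with positive probability. Hence the sum over all `w` of
`r ^ (-|w|) ν(w) ^ 2` is almost surely finite if `q < r < 1` (`PlaneTree.lintegral_energy_le`), and it
is a measurable function of the tree.
-/

open scoped NNReal

namespace PlaneTree

/-! ### Splitting the unit interval along the tree -/

theorem childCount_eq_of_forall (t : PlaneTree) {w : List ℕ} {n : ℕ}
    (h : ∀ j, w ++ [j] ∈ t.verts ↔ j < n) : t.childCount w = n := by
  have : {j : ℕ | w ++ [j] ∈ t.verts} = Set.Iio n := Set.ext h
  rw [childCount, this, ← Finset.coe_Iio, Set.ncard_coe_finset, Nat.card_Iio]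

theorem mem_iff_lt_childCount (t : PlaneTree) (w : List ℕ) (j : ℕ) :
    w ++ [j] ∈ t.verts ↔ j < t.childCount w := by
  by_cases hw : w ∈ t.verts
  · obtain ⟨n, hn⟩ := t.exists_count w hw
    rw [t.childCount_eq_of_forall hn, hn]
  · have h : ∀ i, w ++ [i] ∈ t.verts ↔ i < 0 := fun i =>
      ⟨fun hi => (hw (t.mem_of_prefix _ _ (List.prefix_append _ _) hi)).elim,
        fun hi => (Nat.not_lt_zero _ hi).elim⟩
    rw [t.childCount_eq_of_forall h, h]

theorem mem_of_append_mem (t : PlaneTree) {w w' : List ℕ} (h : w ++ w' ∈ t.verts) :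
    w ∈ t.verts :=
  t.mem_of_prefix _ _ (List.prefix_append _ _) h

theorem ofCounts_childCount (c : List ℕ → ℕ) {w : List ℕ} (hw : w ∈ (ofCounts c).verts) :
    (ofCounts c).childCount w = c w := by
  refine childCount_eq_of_forall _ fun j => ⟨fun h => h w j (List.prefix_refl _), ?_⟩
  intro hj p i hp
  rcases List.prefix_concat_iff.1 hp with h | h
  · obtain ⟨rfl, h2⟩ := List.append_inj' h rfl
    simp only [List.cons.injEq, and_true] at h2
    exact h2 ▸ hj
  · exact hw p i h

/-- The mass received by the vertex `w` when a unit mass starts from the root and each vertex shares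
its mass equally between its children. It is defined for all words, but only meaningful for those in
the tree, whose proper prefixes all have at least one child. -/
noncomputable def mass (t : PlaneTree) (w : List ℕ) : ℝ≥0 :=
  ∏ k ∈ Finset.range w.length, (t.childCount (w.take k) : ℝ≥0)⁻¹

/-- The total mass of the vertices to the left of `w` in its generation, so that the vertex `w`
occupies the interval from `t.massLeft w` to `t.massLeft w + t.mass w` in `[0, 1]`. -/
noncomputable def massLeft (t : PlaneTree) (w : List ℕ) : ℝ :=
  ∑ k ∈ Finset.range w.length, (w.getD k 0 : ℝ) * t.mass (w.take (k + 1))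

@[simp]
theorem mass_nil (t : PlaneTree) : t.mass [] = 1 := by simp [mass]

@[simp]
theorem massLeft_nil (t : PlaneTree) : t.massLeft [] = 0 := by simp [massLeft]

theorem mass_append (t : PlaneTree) (w : List ℕ) (j : ℕ) :
    t.mass (w ++ [j]) = t.mass w * (t.childCount w : ℝ≥0)⁻¹ := by
  rw [mass, mass, List.length_append, List.length_singleton, Finset.prod_range_succ]
  congr 1
  · refine Finset.prod_congr rfl fun k hk => ?_
    rw [List.take_append_of_le_length (Finset.mem_range.1 hk).le]
  · simp

theorem massLeft_append (t : PlaneTree) (w : List ℕ) (j : ℕ) :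
    t.massLeft (w ++ [j]) = t.massLeft w + j * t.mass (w ++ [j]) := by
  rw [massLeft, massLeft, List.length_append, List.length_singleton, Finset.sum_range_succ]
  congr 1
  · refine Finset.sum_congr rfl fun k hk => ?_
    have hk' := Finset.mem_range.1 hk
    rw [List.take_append_of_le_length hk', List.getD_append _ _ _ _ hk']
  · have : (w ++ [j]).take (w.length + 1) = w ++ [j] := List.take_of_length_le (by simp)
    rw [this]
    simp

/-- The interval of `[0, 1]` occupied by `w`. -/
def massIcc (t : PlaneTree) (w : List ℕ) : Set ℝ := Set.Icc (t.massLeft w) (t.massLeft w + t.mass w)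

theorem childCount_mul_mass_append (t : PlaneTree) {w : List ℕ} {j : ℕ}
    (h : w ++ [j] ∈ t.verts) :
    (t.childCount w : ℝ) * t.mass (w ++ [j]) = t.mass w := by
  have h0 : (t.childCount w : ℝ) ≠ 0 := by
    have := (t.mem_iff_lt_childCount w j).1 h
    exact_mod_cast (Nat.zero_lt_of_lt this).ne'
  rw [mass_append]
  push_cast
  field_simp

theorem massIcc_append_subset (t : PlaneTree) {w : List ℕ} {j : ℕ} (h : w ++ [j] ∈ t.verts) :
    t.massIcc (w ++ [j]) ⊆ t.massIcc w := by
  have h1 := t.childCount_mul_mass_append h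
  have h2 : ((j : ℝ) + 1) ≤ t.childCount w := by
    exact_mod_cast (t.mem_iff_lt_childCount w j).1 h
  have h3 : (0 : ℝ) ≤ t.mass (w ++ [j]) := NNReal.coe_nonneg _
  have h4 : (0 : ℝ) ≤ j := Nat.cast_nonneg _
  refine Set.Icc_subset_Icc ?_ ?_
  · rw [massLeft_append]
    nlinarith
  · rw [massLeft_append]
    nlinarith

theorem massLeft_mem_massIcc (t : PlaneTree) (w : List ℕ) : t.massLeft w ∈ t.massIcc w :=
  ⟨le_rfl, by simp⟩

theorem massRight_mem_massIcc (t : PlaneTree) (w : List ℕ) :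
    t.massLeft w + t.mass w ∈ t.massIcc w :=
  ⟨by simp, le_rfl⟩

theorem leftmost_succ (w : List ℕ) (n : ℕ) : leftmost w (n + 1) = leftmost w n ++ [0] := by
  simp [leftmost, List.replicate_succ']

theorem massLeft_leftmost (t : PlaneTree) (w : List ℕ) (n : ℕ) :
    t.massLeft (leftmost w n) = t.massLeft w := by
  induction n with
  | zero => simp [leftmost]
  | succ n ih => rw [leftmost_succ, massLeft_append, ih]; simp

theorem massRight_rightmost (t : PlaneTree) (w : List ℕ) (n : ℕ)
    (h : t.rightmost w n ∈ t.verts) :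
    t.massLeft (t.rightmost w n) + t.mass (t.rightmost w n) = t.massLeft w + t.mass w := by
  induction n with
  | zero => rfl
  | succ n ih =>
    rw [rightmost] at h ⊢
    have h1 := t.childCount_mul_mass_append h
    have h2 : 1 ≤ t.childCount (t.rightmost w n) :=
      Nat.one_le_of_lt ((t.mem_iff_lt_childCount _ _).1 h)
    rw [← ih (t.mem_of_append_mem h), massLeft_append, ← h1]
    push_cast [h2]
    ring

/-- The point of `[0, 1]` that separates the vertices on the left of a face from those on its
right. -/
noncomputable def Face.point {t : PlaneTree} (f : t.Face) : ℝ :=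
  t.massLeft (f.base ++ [f.idx + 1])

theorem Face.point_eq {t : PlaneTree} (f : t.Face) :
    f.point = t.massLeft (f.base ++ [f.idx]) + t.mass (f.base ++ [f.idx]) := by
  rw [point, massLeft_append, massLeft_append, mass_append, mass_append]
  push_cast
  ring

/-- On the left of a face, the intervals along the rightmost ray share their right endpoint, and on
its right, those along the leftmost ray share their left endpoint. -/
theorem Face.point_mem_massIcc {t : PlaneTree} (f : t.Face) (n : ℤ)
    (h : f.boundary n ∈ t.verts) : f.point ∈ t.massIcc (f.boundary n) := by
  match n with
  | Int.ofNat 0 =>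
    exact t.massIcc_append_subset f.idx_mem (t.massLeft_mem_massIcc _)
  | Int.ofNat (n + 1) =>
    change f.point ∈ t.massIcc (t.rightmost (f.base ++ [f.idx]) n)
    rw [f.point_eq, ← t.massRight_rightmost _ n h]
    exact t.massRight_mem_massIcc _
  | Int.negSucc n =>
    change f.point ∈ t.massIcc (leftmost (f.base ++ [f.idx + 1]) n)
    rw [Face.point, ← t.massLeft_leftmost _ n]
    exact t.massLeft_mem_massIcc _

/-! ### Crossing the slice -/

section Slice

variable (t : PlaneTree) (s : t.Face → Strip.{u})

open Classical in
/-- A vertex of the slice is either a vertex of the tree or lies in the interior of the strip glued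
in one face. -/
noncomputable def place : t.SliceVertex s → t.verts ⊕ t.Face :=
  Quot.lift
    (Sum.elim Sum.inl fun x : Σ f : t.Face, (s f).Vertex =>
      if h : ∃ n : ℤ, (s x.1).boundary n = x.2 ∧ x.1.boundary n ∈ t.verts then
        Sum.inl ⟨x.1.boundary h.choose, h.choose_spec.2⟩
      else Sum.inr x.1)
    (by
      rintro _ _ ⟨f, n, w, hw⟩
      have h : ∃ m : ℤ, (s f).boundary m = (s f).boundary n ∧ f.boundary m ∈ t.verts :=
        ⟨n, rfl, hw ▸ w.2⟩
      have h' : h.choose = n := (s f).simple_boundary h.choose_spec.1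
      simp only [Sum.elim_inl, Sum.elim_inr, dif_pos h, Sum.inl.injEq]
      exact Subtype.ext (by rw [hw]; simp only [h']))

theorem place_treeVertex (w : t.verts) : t.place s (t.treeVertex s w) = Sum.inl w := rfl

theorem place_stripVertex (f : t.Face) (x : (s f).Vertex) :
    t.place s (t.stripVertex s f x) = Sum.inr f ∨
      ∃ (w : t.verts) (n : ℤ), t.place s (t.stripVertex s f x) = Sum.inl w ∧
        (w : List ℕ) = f.boundary n ∧ t.stripVertex s f x = t.treeVertex s w := by
  by_cases h : ∃ n : ℤ, (s f).boundary n = x ∧ f.boundary n ∈ t.verts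
  · refine Or.inr ⟨⟨f.boundary h.choose, h.choose_spec.2⟩, h.choose, ?_, rfl, ?_⟩
    · exact dif_pos h
    · have := Quot.sound (Glue.mk (s := s) f h.choose ⟨f.boundary h.choose, h.choose_spec.2⟩ rfl)
      exact (congrArg (t.stripVertex s f) h.choose_spec.1).symm.trans this.symm
  · exact Or.inl (dif_neg h)

/-- The mass of a vertex of the slice, which is zero in the interior of the strips. -/
noncomputable def sliceMass (z : t.SliceVertex s) : ℝ≥0 :=
  Sum.elim (fun w : t.verts => t.mass w) (fun _ => 0) (t.place s z)

/-- The subset of `[0, 1]` covered by a vertex of the slice: the interval of a vertex of the tree, or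
the separating point of the face for a vertex in the interior of a strip. -/
noncomputable def sliceIcc (z : t.SliceVertex s) : Set ℝ :=
  Sum.elim (fun w : t.verts => t.massIcc w) (fun f => {f.point}) (t.place s z)

theorem sub_le_sliceMass {z : t.SliceVertex s} {a b : ℝ} (ha : a ∈ t.sliceIcc s z)
    (hb : b ∈ t.sliceIcc s z) : b - a ≤ t.sliceMass s z := by
  unfold sliceMass
  unfold sliceIcc at ha hb
  rcases h : t.place s z with w | f
  · simp only [h, Sum.elim_inl, massIcc, Set.mem_Icc] at *
    linarith
  · simp only [h, Sum.elim_inr, Set.mem_singleton_iff] at *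
    simp [ha, hb]

theorem point_mem_sliceIcc (f : t.Face) (x : (s f).Vertex) :
    f.point ∈ t.sliceIcc s (t.stripVertex s f x) := by
  unfold sliceIcc
  rcases t.place_stripVertex s f x with h | ⟨w, n, h, hw, -⟩
  · rw [h]
    exact rfl
  · rw [h, Sum.elim_inl, hw]
    exact f.point_mem_massIcc n (hw ▸ w.2)

theorem exists_mem_sliceIcc_of_adj {z z' : t.SliceVertex s} (h : (t.slice s).Adj z z') :
    ∃ c, c ∈ t.sliceIcc s z ∧ c ∈ t.sliceIcc s z' := by
  have key : ∀ {z z'}, t.SliceEdge s z z' → ∃ c, c ∈ t.sliceIcc s z ∧ c ∈ t.sliceIcc s z' := by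
    rintro _ _ (⟨w, w', j, h⟩ | ⟨f, x, y, h⟩)
    · refine ⟨t.massLeft w', ?_, t.massLeft_mem_massIcc w'⟩
      change _ ∈ t.massIcc w
      have hm := w'.2
      rw [h] at hm ⊢
      exact t.massIcc_append_subset hm (t.massLeft_mem_massIcc _)
    · exact ⟨f.point, t.point_mem_sliceIcc s f x, t.point_mem_sliceIcc s f y⟩
  rcases (SimpleGraph.fromRel_adj _ _ _).1 h |>.2 with h | h
  · exact key h
  · obtain ⟨c, h1, h2⟩ := key h
    exact ⟨c, h2, h1⟩

theorem sub_le_sum_sliceMass {x y : t.SliceVertex s} (γ : (t.slice s).Walk x y) {a b : ℝ}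
    (ha : a ∈ t.sliceIcc s x) (hb : b ∈ t.sliceIcc s y) :
    b - a ≤ ∑ i ∈ Finset.range (γ.length + 1), (t.sliceMass s (γ.getVert i) : ℝ) := by
  induction γ generalizing a with
  | nil => simpa using t.sub_le_sliceMass s ha hb
  | cons h p ih =>
    obtain ⟨c, h1, h2⟩ := t.exists_mem_sliceIcc_of_adj s h
    have h3 := ih h2 hb
    have h4 := t.sub_le_sliceMass s ha h1
    rw [SimpleGraph.Walk.length_cons, Finset.sum_range_succ']
    simp only [SimpleGraph.Walk.getVert_cons_succ, SimpleGraph.Walk.getVert_zero]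
    linarith

/-- A path that crosses the slice covers `[0, 1]`, so it has total mass at least one. -/
theorem one_le_sum_sliceMass {x y : t.SliceVertex s} (hx : x ∈ t.leftBoundary s)
    (hy : y ∈ t.rightBoundary s) (γ : (t.slice s).Walk x y) :
    1 ≤ ∑ i ∈ Finset.range (γ.length + 1), (t.sliceMass s (γ.getVert i) : ℝ) := by
  obtain ⟨w, ⟨n, hw⟩, rfl⟩ := hx
  obtain ⟨w', ⟨n', hw'⟩, rfl⟩ := hy
  have h0 : (0 : ℝ) ∈ t.massIcc w := by
    rw [← t.massLeft_nil, ← t.massLeft_leftmost [] n, ← hw]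
    exact t.massLeft_mem_massIcc _
  have h1 : (1 : ℝ) ∈ t.massIcc w' := by
    have := t.massRight_rightmost [] n' (hw' ▸ w'.2)
    rw [← hw', massLeft_nil, mass_nil, NNReal.coe_one, zero_add] at this
    rw [← this]
    exact t.massRight_mem_massIcc _
  simpa using t.sub_le_sum_sliceMass s γ (a := 0) (b := 1) h0 h1

/-! ### Distances in the slice -/

theorem exists_walk_root (w : List ℕ) (hw : w ∈ t.verts) :
    ∃ p : (t.slice s).Walk (t.sliceRoot s) (t.treeVertex s ⟨w, hw⟩), p.length ≤ w.length := by
  induction w using List.reverseRecOn with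
  | nil => exact ⟨SimpleGraph.Walk.nil, le_rfl⟩
  | append_singleton w j ih =>
    have hw' := t.mem_of_append_mem hw
    obtain ⟨p, hp⟩ := ih hw'
    have hadj : (t.slice s).Adj (t.treeVertex s ⟨w, hw'⟩) (t.treeVertex s ⟨w ++ [j], hw⟩) := by
      refine (SimpleGraph.fromRel_adj _ _ _).2 ⟨fun h => ?_, Or.inl (SliceEdge.tree _ _ j rfl)⟩
      have h2 := congrArg (t.place s) h
      simp [place_treeVertex] at h2
    refine ⟨p.concat hadj, ?_⟩
    simpa using hp

theorem dist_treeVertex_le (w : t.verts) :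
    (t.slice s).dist (t.sliceRoot s) (t.treeVertex s w) ≤ (w : List ℕ).length := by
  obtain ⟨p, hp⟩ := t.exists_walk_root s w w.2
  exact (SimpleGraph.dist_le p).trans hp

theorem sliceMass_le {C ϑ : ℝ} (hC : 0 ≤ C) (h0 : 0 ≤ ϑ) (h1 : ϑ ≤ 1)
    (h : ∀ w ∈ t.verts, (t.mass w : ℝ) ≤ C * ϑ ^ w.length) (z : t.SliceVertex s) :
    (t.sliceMass s z : ℝ) ≤ C * ϑ ^ (t.slice s).dist (t.sliceRoot s) z := by
  have key : ∀ w : t.verts, (t.sliceMass s (t.treeVertex s w) : ℝ) ≤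
      C * ϑ ^ (t.slice s).dist (t.sliceRoot s) (t.treeVertex s w) := fun w =>
    (h w w.2).trans <| mul_le_mul_of_nonneg_left
      (pow_le_pow_of_le_one h0 h1 (t.dist_treeVertex_le s w)) hC
  rcases z with ⟨w | ⟨f, x⟩⟩
  · exact key w
  · change (t.sliceMass s (t.stripVertex s f x) : ℝ) ≤
      C * ϑ ^ (t.slice s).dist (t.sliceRoot s) (t.stripVertex s f x)
    rcases t.place_stripVertex s f x with h | ⟨w, n, -, -, h⟩
    · rw [sliceMass, h]
      simp only [Sum.elim_inr, NNReal.coe_zero]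
      positivity
    · rw [h]
      exact key w

end Slice

end PlaneTree

/-- The times at which a geodesic is at distances `d` and `d'` from a given point differ by at most
`d + d'`. -/
theorem SimpleGraph.Walk.le_add_dist_add_dist {V : Type*} {G : SimpleGraph V} {x y o : V}
    (γ : G.Walk x y) (hγ : γ.length = G.dist x y) (ho : G.Reachable o x) {i j : ℕ}
    (hj : j ≤ γ.length) :
    j ≤ i + (G.dist o (γ.getVert i) + G.dist o (γ.getVert j)) := by
  obtain ⟨p, hp⟩ := (ho.trans ⟨γ.take i⟩).exists_walk_length_eq_dist
  obtain ⟨q, hq⟩ := (ho.trans ⟨γ.take j⟩).exists_walk_length_eq_dist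
  have h := SimpleGraph.dist_le ((γ.take i).append (p.reverse.append (q.append (γ.drop j))))
  simp only [SimpleGraph.Walk.length_append, SimpleGraph.Walk.length_reverse, hp, hq,
    SimpleGraph.Walk.take_length, SimpleGraph.Walk.drop_length, ← hγ] at h
  have := min_le_left i γ.length
  omega

/-! ### Sums of geometric weights along a geodesic -/

/-- A sequence `d` in which at most `2 n + 1` terms are equal to `n`, and all of whose terms are
large, has a small sum of geometric weights `ϑ ^ d i`. -/
theorem exists_forall_sum_pow_lt {ϑ ε : ℝ} (h0 : 0 ≤ ϑ) (h1 : ϑ < 1) (hε : 0 < ε) :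
    ∃ K : ℕ, ∀ (L : ℕ) (d : ℕ → ℕ), (∀ i ≤ L, ∀ j ≤ L, j ≤ i + (d i + d j)) →
      (∀ i ≤ L, K < d i) → ∑ i ∈ Finset.range (L + 1), ϑ ^ d i < ε := by
  have hsum : Summable fun n : ℕ => (2 * (n : ℝ) + 1) * ϑ ^ n := by
    have ha := summable_pow_mul_geometric_of_norm_lt_one 1 (r := ϑ) (by
      rwa [Real.norm_of_nonneg h0])
    have hb := summable_geometric_of_lt_one h0 h1
    refine ((ha.mul_left 2).add hb).congr fun n => ?_
    ring
  obtain ⟨F, hF⟩ := summable_iff_vanishing_norm.1 hsum ε hε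
  refine ⟨F.sup id, fun L d hd hK => ?_⟩
  set I := (Finset.range (L + 1)).image d
  have hdisj : Disjoint I F := by
    refine Finset.disjoint_left.2 fun n hn hnF => ?_
    obtain ⟨i, hi, rfl⟩ := Finset.mem_image.1 hn
    have := Finset.le_sup (f := id) hnF
    exact (hK i (Nat.lt_succ_iff.1 (Finset.mem_range.1 hi))).not_ge this
  refine lt_of_le_of_lt ?_ (lt_of_le_of_lt (le_abs_self _) (hF I hdisj))
  rw [Finset.sum_comp (fun n => ϑ ^ n) d]
  refine Finset.sum_le_sum fun n hn => ?_
  rw [nsmul_eq_mul]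
  refine mul_le_mul_of_nonneg_right ?_ (by positivity)
  have hne : ((Finset.range (L + 1)).filter fun i => d i = n).Nonempty := by
    obtain ⟨i, hi, h⟩ := Finset.mem_image.1 hn
    exact ⟨i, Finset.mem_filter.2 ⟨hi, h⟩⟩
  -- The indices at which `d` takes the value `n` lie within `2 n` of the first of them.
  set m := ((Finset.range (L + 1)).filter fun i => d i = n).min' hne with hm
  have hmem := Finset.mem_filter.1 (Finset.min'_mem _ hne)
  rw [← hm, Finset.mem_range] at hmem
  have hsub : ((Finset.range (L + 1)).filter fun i => d i = n) ⊆ Finset.Icc m (m + 2 * n) := by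
    intro i hi
    have h2 := Finset.min'_le _ _ hi
    rw [Finset.mem_filter, Finset.mem_range] at hi
    have := hd m (by omega) i (by omega)
    rw [Finset.mem_Icc]
    omega
  have hcard := Finset.card_le_card hsub
  rw [Nat.card_Icc] at hcard
  have : (Finset.card ((Finset.range (L + 1)).filter fun i => d i = n)) ≤ 2 * n + 1 := by omega
  exact_mod_cast this

namespace PlaneTree

/-- If the masses decay exponentially with the generation, then all geodesics that cross the slice
come close to the root, at a distance that does not depend on the strips. -/
theorem exists_dist_le_of_mass_le {C ϑ : ℝ} (hC : 0 ≤ C) (h0 : 0 ≤ ϑ) (h1 : ϑ < 1) :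
    ∃ K : ℕ, ∀ (t : PlaneTree) (s : t.Face → Strip.{u}),
      (∀ w ∈ t.verts, (t.mass w : ℝ) ≤ C * ϑ ^ w.length) →
      ∀ x ∈ t.leftBoundary s, ∀ y ∈ t.rightBoundary s, ∀ γ : (t.slice s).Walk x y,
        γ.length = (t.slice s).dist x y →
          ∃ z ∈ γ.support, (t.slice s).dist (t.sliceRoot s) z ≤ K := by
  obtain ⟨K, hK⟩ := exists_forall_sum_pow_lt h0 h1 (ε := (C + 1)⁻¹) (by positivity)
  refine ⟨K, fun t s h x hx y hy γ hγ => ?_⟩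
  by_contra! hfar
  have hreach : (t.slice s).Reachable (t.sliceRoot s) x := by
    obtain ⟨w, -, rfl⟩ := hx
    exact ⟨(t.exists_walk_root s w w.2).choose⟩
  have hlt := hK γ.length (fun i => (t.slice s).dist (t.sliceRoot s) (γ.getVert i))
    (fun i _ j hj => γ.le_add_dist_add_dist hγ hreach hj)
    (fun i _ => hfar _ (γ.getVert_mem_support i))
  have hone := t.one_le_sum_sliceMass s hx hy γ
  have hle : ∑ i ∈ Finset.range (γ.length + 1), (t.sliceMass s (γ.getVert i) : ℝ) ≤
      C * ∑ i ∈ Finset.range (γ.length + 1),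
        ϑ ^ (t.slice s).dist (t.sliceRoot s) (γ.getVert i) := by
    rw [Finset.mul_sum]
    exact Finset.sum_le_sum fun i _ => t.sliceMass_le s hC h0 h1.le h _
  have h2 : C * ∑ i ∈ Finset.range (γ.length + 1),
      ϑ ^ (t.slice s).dist (t.sliceRoot s) (γ.getVert i) ≤ C * (C + 1)⁻¹ :=
    mul_le_mul_of_nonneg_left hlt.le hC
  have h3 : C * (C + 1)⁻¹ < 1 := by
    rw [← div_eq_mul_inv, div_lt_one (by positivity)]
    linarith
  linarith

end PlaneTree

/-! ### Exponential decay of the masses in a Galton-Watson tree -/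

theorem ENNReal.tsum_prod_fin_eq_pow {α : Type*} (a : α → ℝ≥0∞) (n : ℕ) :
    ∑' f : Fin n → α, ∏ k, a (f k) = (∑' j, a j) ^ n := by
  induction n with
  | zero => simp
  | succ n ih =>
    rw [← (Fin.consEquiv fun _ : Fin (n + 1) => α).tsum_eq, ENNReal.tsum_prod', pow_succ', ← ih,
      ← ENNReal.tsum_mul_right]
    refine tsum_congr fun j => ?_
    rw [← ENNReal.tsum_mul_left]
    refine tsum_congr fun f => ?_
    simp [Fin.consEquiv, Fin.prod_univ_succ]

theorem ENNReal.tsum_list_prod_eq {α : Type*} (a : α → ℝ≥0∞) :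
    ∑' w : List α, ∏ k : Fin w.length, a (w.get k) = (1 - ∑' j, a j)⁻¹ := by
  rw [← ENNReal.tsum_geometric]
  simp_rw [← ENNReal.tsum_prod_fin_eq_pow]
  rw [← ENNReal.tsum_sigma' fun p : Σ n, Fin n → α => ∏ k, a (p.2 k),
    ← List.equivSigmaTuple.tsum_eq]
  rfl

namespace PlaneTree

theorem measurableSet_mem_verts (w : List ℕ) : MeasurableSet {t : PlaneTree | w ∈ t.verts} :=
  ⟨{A | w ∈ A}, measurableSet_setOfPred.2 (measurable_set_mem w), rfl⟩

theorem measurable_childCount (w : List ℕ) : Measurable fun t : PlaneTree => t.childCount w := by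
  refine measurable_of_Iic fun n => ?_
  have : (fun t : PlaneTree => t.childCount w) ⁻¹' Set.Iic n = {t | w ++ [n] ∈ t.verts}ᶜ := by
    ext t
    simp [t.mem_iff_lt_childCount]
  rw [this]
  exact (measurableSet_mem_verts _).compl

theorem measurable_mass (w : List ℕ) : Measurable fun t : PlaneTree => t.mass w := by
  unfold mass
  refine Finset.measurable_prod _ fun k _ => ?_
  exact (measurable_from_nat (f := fun n : ℕ => (n : ℝ≥0)⁻¹)).comp (measurable_childCount _)

/-- The sum over all vertices `w` of the squares of their masses, with weights `β ^ |w|`. -/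
noncomputable def energy (β : ℝ≥0) (t : PlaneTree) : ℝ≥0∞ :=
  ∑' w : List ℕ, t.verts.indicator (fun w => ((t.mass w ^ 2 * β ^ w.length : ℝ≥0) : ℝ≥0∞)) w

theorem measurable_energy (β : ℝ≥0) : Measurable (energy β) := by
  classical
  refine Measurable.tsum fun w => ?_
  simp only [Set.indicator_apply]
  refine Measurable.ite (measurableSet_mem_verts w) ?_ measurable_const
  exact (((measurable_mass w).pow_const 2).mul_const _).coe_nnreal_ennreal

/-- The contribution to the energy of a vertex with `n` children, for a path that goes to its child
number `j`. -/
noncomputable def energyFactor (β : ℝ≥0) (j n : ℕ) : ℝ≥0∞ :=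
  if j < n then (((n : ℝ≥0)⁻¹ ^ 2 * β : ℝ≥0) : ℝ≥0∞) else 0

theorem tsum_energyFactor (β : ℝ≥0) (n : ℕ) :
    ∑' j, energyFactor β j n = (((n : ℝ≥0)⁻¹ * β : ℝ≥0) : ℝ≥0∞) := by
  unfold energyFactor
  rw [tsum_eq_sum (s := Finset.range n) fun j hj => if_neg (by simpa using hj),
    Finset.sum_congr rfl fun j hj => if_pos (Finset.mem_range.1 hj), Finset.sum_const,
    Finset.card_range, nsmul_eq_mul, ← ENNReal.coe_natCast,
    ← ENNReal.coe_mul]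
  congr 1
  rcases eq_or_ne (n : ℝ≥0) 0 with h | h
  · simp [h]
  · field_simp

theorem indicator_ofCounts_le (β : ℝ≥0) (c : List ℕ → ℕ) (w : List ℕ) :
    (ofCounts c).verts.indicator
        (fun w => (((ofCounts c).mass w ^ 2 * β ^ w.length : ℝ≥0) : ℝ≥0∞)) w ≤
      ∏ k : Fin w.length, energyFactor β (w.get k) (c (w.take k)) := by
  by_cases hw : w ∈ (ofCounts c).verts
  swap
  · rw [Set.indicator_of_notMem hw]
    exact zero_le
  rw [Set.indicator_of_mem hw]
  refine le_of_eq ?_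
  unfold energyFactor
  have hlt : ∀ k : Fin w.length, w.get k < c (w.take k) := fun k => by
    refine hw _ _ ?_
    rw [List.get_eq_getElem, List.take_concat_get']
    exact List.take_prefix _ _
  have hmem : ∀ k, w.take k ∈ (ofCounts c).verts := fun k =>
    (ofCounts c).mem_of_prefix _ _ (List.take_prefix _ _) hw
  rw [Finset.prod_congr rfl fun k _ => if_pos (hlt k), ← ENNReal.ofNNReal_finsetProd,
    Finset.prod_mul_distrib, Finset.prod_pow, Finset.prod_const, Finset.card_univ,
    Fintype.card_fin, mass, ← Fin.prod_univ_eq_prod_range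
      (fun k => ((ofCounts c).childCount (w.take k) : ℝ≥0)⁻¹)]
  simp_rw [ofCounts_childCount c (hmem _)]

/-- The proper prefixes of `w` are distinct words, so their numbers of children are independent. -/
theorem lintegral_prod_energyFactor (β : ℝ≥0) (μ : PMF ℕ) (w : List ℕ) :
    ∫⁻ c, ∏ k : Fin w.length, energyFactor β (w.get k) (c (w.take k))
        ∂(Measure.infinitePi fun _ : List ℕ => μ.toMeasure) =
      ∏ k : Fin w.length, ∑' n, energyFactor β (w.get k) n * μ n := by
  have hinj : Function.Injective fun k : Fin w.length => w.take k := fun k l h => by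
    have := congrArg List.length h
    simp only [List.length_take] at this
    ext
    omega
  have hind := (iIndepFun_infinitePi (P := fun _ : List ℕ => μ.toMeasure)
    (X := fun _ n => n) fun _ => measurable_id).precomp hinj
  have hind' := hind.comp (fun k n => energyFactor β (w.get k) n) fun _ => measurable_from_nat
  rw [lintegral_prod_eq_prod_lintegral_of_indepFun Finset.univ
    (fun (k : Fin w.length) (c : List ℕ → ℕ) => energyFactor β (w.get k) (c (w.take k))) hind'
    fun k => (measurable_from_nat (f := energyFactor β (w.get k))).comp (measurable_pi_apply _)]
  refine Finset.prod_congr rfl fun k _ => ?_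
  have hev := measurePreserving_eval_infinitePi (fun _ : List ℕ => μ.toMeasure) (w.take k)
  have := hev.lintegral_comp (f := fun n => energyFactor β (w.get k) n) measurable_from_nat
  refine this.trans ?_
  rw [lintegral_countable']
  simp_rw [PMF.toMeasure_apply_singleton _ _ (measurableSet_singleton _)]

/-- Since the mass of a vertex with `n` children is shared equally, the squares of the masses
of its children add up to the square of its mass divided by `n`. Their expected sum over a generation
is therefore a power of the mean of `1 / n`. -/
theorem lintegral_energy_le (β : ℝ≥0) (μ : PMF ℕ) :
    ∫⁻ t, energy β t ∂galtonWatson μ ≤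
      (1 - (∑' n : ℕ, ((n : ℝ≥0)⁻¹ : ℝ≥0) * μ n) * β)⁻¹ := by
  have hsum : ∑' j, ∑' n, energyFactor β j n * μ n =
      (∑' n : ℕ, ((n : ℝ≥0)⁻¹ : ℝ≥0) * μ n) * β := by
    rw [ENNReal.tsum_comm, ← ENNReal.tsum_mul_right]
    refine tsum_congr fun n => ?_
    rw [ENNReal.tsum_mul_right, tsum_energyFactor, ENNReal.coe_mul]
    ring
  rw [galtonWatson, lintegral_map (measurable_energy β) measurable_ofCounts, ← hsum,
    ← ENNReal.tsum_list_prod_eq]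
  refine (lintegral_mono fun c =>
    ENNReal.tsum_le_tsum fun w => indicator_ofCounts_le β c w).trans ?_
  have hmeas : ∀ w : List ℕ, Measurable fun c : List ℕ → ℕ =>
      ∏ k : Fin w.length, energyFactor β (w.get k) (c (w.take k)) := fun w =>
    Finset.measurable_prod _ fun k _ =>
      (measurable_from_nat (f := energyFactor β (w.get k))).comp (measurable_pi_apply _)
  rw [lintegral_tsum fun w => (hmeas w).aemeasurable]
  exact le_of_eq (tsum_congr fun w => lintegral_prod_energyFactor β μ w)

theorem tsum_inv_mul_lt_one (μ : PMF ℕ) (hμ : 1 < ∑' i : ℕ, (i : ℝ≥0∞) * μ i) :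
    ∑' n : ℕ, ((n : ℝ≥0)⁻¹ : ℝ≥0) * μ n < 1 := by
  have hle : ∀ n : ℕ, (((n : ℝ≥0)⁻¹ : ℝ≥0) : ℝ≥0∞) ≤ 1 := fun n => by
    exact_mod_cast Nat.cast_inv_le_one n
  have hle' : ∀ n : ℕ, ((n : ℝ≥0)⁻¹ : ℝ≥0) * μ n ≤ μ n := fun n =>
    mul_le_of_le_one_left zero_le (hle n)
  obtain ⟨n, hn, hμn⟩ : ∃ n, 2 ≤ n ∧ μ n ≠ 0 := by
    by_contra! h
    have h1 : ∑' i : ℕ, (i : ℝ≥0∞) * μ i ≤ 1 := by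
      rw [← μ.tsum_coe]
      refine ENNReal.tsum_le_tsum fun i => ?_
      rcases Nat.lt_or_ge i 2 with hi | hi
      · exact mul_le_of_le_one_left zero_le (by exact_mod_cast Nat.lt_succ_iff.1 hi)
      · simp [h i hi]
    exact hμ.not_ge h1
  rw [← μ.tsum_coe]
  have htop : ∑' n : ℕ, ((n : ℝ≥0)⁻¹ : ℝ≥0) * μ n ≠ ∞ :=
    ((ENNReal.tsum_le_tsum hle').trans μ.tsum_coe.le).trans_lt ENNReal.one_lt_top |>.ne
  refine ENNReal.tsum_lt_tsum htop hle' (i := n) ?_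
  have h1 : (((n : ℝ≥0)⁻¹ : ℝ≥0) : ℝ≥0∞) < 1 := by
    exact_mod_cast inv_lt_one_of_one_lt₀ (by exact_mod_cast hn : (1 : ℝ≥0) < n)
  calc _ < 1 * μ n := ENNReal.mul_lt_mul_left hμn (μ.apply_ne_top n) h1
    _ = μ n := one_mul _

/-- The mass of a vertex is at most the square root of its share of the energy. -/
theorem mass_le_of_energy_le {β : ℝ≥0} (hβ : β ≠ 0) {t : PlaneTree} {N : ℝ≥0} (h : energy β t ≤ N)
    (w : List ℕ) (hw : w ∈ t.verts) :
    (t.mass w : ℝ) ≤ √N * √(β : ℝ)⁻¹ ^ w.length := by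
  have h1 : ((t.mass w ^ 2 * β ^ w.length : ℝ≥0) : ℝ≥0∞) ≤ N := by
    refine le_trans ?_ h
    refine le_trans (le_of_eq ?_) (ENNReal.le_tsum w)
    rw [Set.indicator_of_mem hw]
  have h2 : (t.mass w : ℝ) ^ 2 * (β : ℝ) ^ w.length ≤ N := by
    exact_mod_cast ENNReal.coe_le_coe.1 h1
  have hβ' : (0 : ℝ) < β := by positivity
  refine le_of_sq_le_sq ?_ (by positivity)
  rw [mul_pow, Real.sq_sqrt (NNReal.coe_nonneg N), ← pow_mul, mul_comm w.length, pow_mul,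
    Real.sq_sqrt (by positivity), inv_pow, ← div_eq_mul_inv, le_div_iff₀ (by positivity)]
  exact h2

end PlaneTree

theorem mainTheorem7 {Ω : Type v} [MeasurableSpace Ω] (P : Measure Ω) [IsProbabilityMeasure P]
    (μ : PMF ℕ) (hμ_zero : μ 0 = 0) (hμ_mean : 1 < ∑' i : ℕ, (i : ℝ≥0∞) * μ i)
    (T : Ω → PlaneTree) (hT : HasLaw T (PlaneTree.galtonWatson μ) P)
    (s : ∀ ω, (T ω).Face → Strip.{u}) :
    ∃ K : Ω → ℕ, Measurable K ∧
      ∀ᵐ ω ∂P, ∀ x ∈ (T ω).leftBoundary (s ω), ∀ y ∈ (T ω).rightBoundary (s ω),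
        ∀ γ : ((T ω).slice (s ω)).Walk x y, γ.length = ((T ω).slice (s ω)).dist x y →
          ∃ z ∈ γ.support, ((T ω).slice (s ω)).dist ((T ω).sliceRoot (s ω)) z ≤ K ω := by
  obtain ⟨r, hr, hr1⟩ := ENNReal.lt_iff_exists_nnreal_btwn.1
    (PlaneTree.tsum_inv_mul_lt_one μ hμ_mean)
  have hr0 : r ≠ 0 := by
    rintro rfl
    simp at hr
  have hr0' : (0 : ℝ) < r := by positivity
  have hr1' : r < 1 := by exact_mod_cast hr1
  -- The weight `r⁻¹` is larger than one, but small enough for the mean energy to be finite.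
  have hfin : ∫⁻ ω, PlaneTree.energy r⁻¹ (T ω) ∂P ≠ ∞ := by
    rw [hT.lintegral_comp (PlaneTree.measurable_energy _).aemeasurable]
    refine ((PlaneTree.lintegral_energy_le r⁻¹ μ).trans_lt ?_).ne
    rw [ENNReal.inv_lt_top, tsub_pos_iff_lt, ENNReal.coe_inv hr0, ← div_eq_mul_inv,
      ENNReal.div_lt_iff (by simp [hr0]) (by simp), one_mul]
    exact hr
  have hmeas : AEMeasurable (fun ω => PlaneTree.energy r⁻¹ (T ω)) P :=
    (PlaneTree.measurable_energy _).comp_aemeasurable hT.aemeasurable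
  have hϑ0 : 0 ≤ √((r⁻¹ : ℝ≥0) : ℝ)⁻¹ := Real.sqrt_nonneg _
  have hϑ1 : √((r⁻¹ : ℝ≥0) : ℝ)⁻¹ < 1 := by
    rw [Real.sqrt_lt' one_pos]
    simpa using hr1'
  choose κ hκ using fun N : ℕ =>
    PlaneTree.exists_dist_le_of_mass_le.{u} (Real.sqrt_nonneg ((N : ℝ≥0) : ℝ)) hϑ0 hϑ1
  refine ⟨fun ω => κ ⌈(hmeas.mk _ ω).toNNReal⌉₊, ?_, ?_⟩
  · exact measurable_from_nat.comp
      (Nat.measurable_ceil.comp hmeas.measurable_mk.ennreal_toNNReal)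
  · filter_upwards [hmeas.ae_eq_mk, ae_lt_top' hmeas hfin] with ω hω hω'
    refine hκ _ (T ω) (s ω) (PlaneTree.mass_le_of_energy_le (inv_ne_zero hr0) ?_)
    rw [← hω, ← ENNReal.coe_toNNReal hω'.ne, ENNReal.toNNReal_coe]
    exact_mod_cast Nat.le_ceil _
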